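/- Consider a single user whose age of information evolves in discrete time. In slot $t=0,1,2,\dots$ the state is $(X(t),\Lambda(t))$, where $X(t)\in\{1,2,\dots\}$ is the age and the arrival indicators $\Lambda(t)\in\{0,1\}$ of the slots $t\ge 1$ are i.i.d. Bernoulli with parameter $p\in(0,1]$; the initial state $(X(0),\Lambda(0))$ is given. In every slot an action $a(t)\in\{0,1\}$ is chosen ($1$ = update, $0$ = idle); then $X(t+1)=1$ if $\Lambda(t)=1$ and $a(t)=1$, and $X(t+1)=X(t)+1$ otherwise. The immediate cost in slot $t$ is $X(t)+1-X(t)\,a(t)\,\Lambda(t)+C\,a(t)$, where $C\in\mathbb R$ is the update cost. A policy is cost-optimal if, from every initial state, it minimizes the average cost $\limsup_{T\to\infty}\frac{1}{T+1}E\big[\sum_{t=0}^{T}\text{cost}(t)\big]$ among all (history-dependent, randomized) policies. For $\bar X\in\{1,2,\dots\}$ the threshold policy with threshold $\bar X$ updates exactly in the states $(x,1)$ with $x\ge\bar X$; $\bar X$ is called optimal if this policy is cost-optimal. An action is called optimal in the state $(x,1)$ if some cost-optimal threshold policy takes it there; the two actions are equally desirable in $(x,1)$ if both are optimal there. The Whittle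 index $I(x,1)$, $x\ge1$, is the cost $C$ that makes both actions equally desirable in $(x,1)$, and $I(0,1):=0$. Ties are broken in favor of idling: $\bar X^*$ denotes an optimal threshold whose policy idles in every state $(x,1)$ in which idling is optimal. Theorem. For every $x\ge 1$ there is exactly one $C\in\mathbb R$ that makes both actions equally desirable in $(x,1)$, namely $I(x,1)=\frac{x^2}{2}-\frac{x}{2}+\frac{x}{p}$. For every $C\ge 0$ the threshold $\bar X^*$ exists and is unique, and for every $x=1,2,\dots$, $$\bar X^*=x\quad\Longleftrightarrow\quad I(x-1,1)\le C<I(x,1).$$ In particular, $\bar X^*$ is monotonically nondecreasing in $C\in[0,\infty)$. -/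

import Mathlib

open Filter

namespace AgeMDP

/-- A state `(x, lam)`: the age `x` of information at the user before the decision, and the
arrival indicator `lam` of the current slot. The states of the model are those with `1 ≤ x`. -/
abbrev State : Type := ℕ × Bool

/-- An action: `true` is "update the user", `false` is "idle". -/
abbrev Action : Type := Bool

/-- The Bernoulli law of the arrival indicator of a slot: `true` with probability `p`,
`false` with probability `1 - p`. -/
noncomputable def arrivalLaw (p : unitInterval) : PMF Bool :=
  PMF.ofFintype
    (fun b => if b then ENNReal.ofReal (p : ℝ) else ENNReal.ofReal (1 - (p : ℝ)))
    (by
      rw [Fintype.sum_bool]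
      simp only [if_true, Bool.false_eq_true, if_false]
      rw [← ENNReal.ofReal_add p.2.1 (sub_nonneg.2 p.2.2)]
      simp)

/-- Age in the next slot: one if an arriving packet is sent, otherwise the age plus one. -/
def nextAge (s : State) (a : Action) : ℕ :=
  if a = true ∧ s.2 = true then 1 else s.1 + 1

/-- The transition law: the age evolves by `nextAge`, the next arrival is a fresh Bernoulli
variable. -/
noncomputable def transition (p : unitInterval) (s : State) (a : Action) : PMF State :=
  (arrivalLaw p).map (fun b => (nextAge s a, b))

/-- `0` or `1` as a real number. -/
def bit (b : Bool) : ℝ := if b then 1 else 0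

/-- The immediate cost `(x + 1 - x * a * lam) + C * a`. -/
def stageCost (C : ℝ) (s : State) (a : Action) : ℝ :=
  ((s.1 : ℝ) + 1 - (s.1 : ℝ) * bit a * bit s.2) + C * bit a

/-- The past state-action pairs, in chronological order. -/
abbrev History : Type := List (State × Action)

/-- A history-dependent randomized policy: the law of the current action given the past
state-action pairs and the current state. -/
abbrev Policy : Type := History → State → PMF Action

/-- Deterministic stationary policy given by a decision rule. -/
noncomputable def stationary (f : State → Action) : Policy :=
  fun _ s => PMF.pure (f s)

/-- The joint law, under policy `μ` from initial state `s₀`, of the state-action pairs of the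
slots `0, …, t - 1` and of the state in slot `t`. -/
noncomputable def historyLaw (p : unitInterval) (μ : Policy) (s₀ : State) :
    ℕ → PMF (History × State)
  | 0 => PMF.pure ([], s₀)
  | t + 1 =>
      (historyLaw p μ s₀ t).bind fun ω =>
        (μ ω.1 ω.2).bind fun a =>
          (transition p ω.2 a).map fun s' => (ω.1 ++ [(ω.2, a)], s')

/-- Sum of the immediate costs along a history. -/
def totalCost (C : ℝ) (h : History) : ℝ :=
  (h.map fun z => stageCost C z.1 z.2).sum

/-- Expected total cost over the slots `0, …, T`. The law has finite support, so the sum is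
a finite sum. -/
noncomputable def expectedCost (p : unitInterval) (C : ℝ) (μ : Policy) (s₀ : State)
    (T : ℕ) : ℝ :=
  ∑' ω : History × State, (historyLaw p μ s₀ (T + 1) ω).toReal * totalCost C ω.1

/-- Long-run average cost. It is taken in the extended reals, since it may be `+∞`. -/
noncomputable def averageCost (p : unitInterval) (C : ℝ) (μ : Policy) (s₀ : State) : EReal :=
  limsup (fun T : ℕ => ((1 / ((T : ℝ) + 1) * expectedCost p C μ s₀ T : ℝ) : EReal)) atTop

/-- A policy is cost-optimal if it minimizes the average cost among all history-dependent
randomized policies, from every initial state. -/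
def CostOptimal (p : unitInterval) (C : ℝ) (μ : Policy) : Prop :=
  ∀ s₀ : State, 1 ≤ s₀.1 → ∀ ν : Policy, averageCost p C μ s₀ ≤ averageCost p C ν s₀

/-- The decision rule with threshold `X`: update if and only if there is an arrival and the
age is at least `X`. -/
def thresholdRule (X : ℕ) (s : State) : Action := s.2 && decide (X ≤ s.1)

/-- `X ∈ {1, 2, …}` is an optimal threshold (ties not yet broken). -/
def OptimalThreshold (p : unitInterval) (C : ℝ) (X : ℕ) : Prop :=
  1 ≤ X ∧ CostOptimal p C (stationary (thresholdRule X))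

/-- The action `a` is optimal in state `s` among threshold-type decisions: it is the action
that some cost-optimal threshold-type policy takes in `s`. -/
def OptimalAction (p : unitInterval) (C : ℝ) (s : State) (a : Action) : Prop :=
  ∃ X : ℕ, OptimalThreshold p C X ∧ thresholdRule X s = a

/-- Both actions are equally desirable in the state `(x, 1)`. -/
def EquallyDesirable (p : unitInterval) (C : ℝ) (x : ℕ) : Prop :=
  OptimalAction p C (x, true) true ∧ OptimalAction p C (x, true) false

/-- The Whittle index `I(x, 1)`: the update cost that makes both actions equally desirable in
the state `(x, 1)`. By convention `I(0, 1) = 0`; the age `0` is not a state of the model. -/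
noncomputable def whittleIndex (p : unitInterval) (x : ℕ) : ℝ :=
  if x = 0 then 0 else Classical.epsilon fun C : ℝ => EquallyDesirable p C x

/-- `X` is the optimal threshold when ties are broken in favor of idling: it is optimal, and
its rule idles in every state `(x, 1)` in which idling is an optimal action. -/
def IdlingOptimalThreshold (p : unitInterval) (C : ℝ) (X : ℕ) : Prop :=
  OptimalThreshold p C X ∧
    ∀ x : ℕ, 1 ≤ x → OptimalAction p C (x, true) false → thresholdRule X (x, true) = false

end AgeMDP

/-!
The average cost of the threshold policy with threshold `X` comes from its Poisson equation, which
is solved in closed form (`gain`, `relValue`, `bias`): the value of entering a slot with age `n` is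
quadratic in `n` up to `X` and linear from `X` on, and continuity at `X` fixes the gain. Since the
mean age stays bounded under a threshold policy, telescoping the equation gives
`averageCost_threshold`.

The same function satisfies the Bellman inequality for all actions when `0 ≤ C` and
`I(X - 1, 1) ≤ C ≤ I(X, 1)` (`bellman`). Telescoping it for an arbitrary policy bounds the expected
cost from below up to a terminal term, which grows at most linearly in the age. A policy beating the
gain would need a mean age growing linearly in time, hence a quadratically growing total cost, which
is absurd (`le_averageCost`). So `X` is optimal among all policies (`optimalThreshold_of_mem`).

Conversely, an optimal threshold does at least as well as its neighbours. The gains at `X` and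
`X + 1` compare as `C` and `I(X, 1)` do (`gain_le_gain_succ_iff`, `gain_succ_le_gain_iff`), so `C`
lies in the interval of `X`. As the closed form of the index is strictly increasing, these intervals
meet only at their endpoints: two thresholds are optimal exactly when `C` is an index, and breaking
ties towards idling turns the intervals into half-open ones.
-/

namespace AgeMDP

/-! ### Expectations under finitely supported laws -/

section Mean

variable {α β : Type*}

/-- The expectation of `F` under the law `P`. It is only used for finitely supported `P`, where
the series is a finite sum and no summability question arises. -/
noncomputable def mean (P : PMF α) (F : α → ℝ) : ℝ := ∑' a, (P a).toReal * F a

theorem mean_eq_sum {P : PMF α} (hP : P.support.Finite) (F : α → ℝ) :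
    mean P F = ∑ a ∈ hP.toFinset, (P a).toReal * F a := by
  refine tsum_eq_sum fun a ha => ?_
  have : P a = 0 := by simpa [PMF.mem_support_iff] using ha
  simp [this]

theorem mean_pure (a : α) (F : α → ℝ) : mean (PMF.pure a) F = F a := by
  unfold mean
  rw [tsum_eq_single a]
  · simp
  · intro b hb
    simp [PMF.pure_apply, hb]

theorem mean_bind {P : PMF α} {f : α → PMF β} (hP : P.support.Finite)
    (hf : ∀ a, (f a).support.Finite) (F : β → ℝ) :
    mean (P.bind f) F = mean P fun a => mean (f a) F := by
  rw [mean_eq_sum hP]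
  have key : ∀ b, ((P.bind f) b).toReal * F b
      = ∑ a ∈ hP.toFinset, (P a).toReal * ((f a b).toReal * F b) := by
    intro b
    rw [PMF.bind_apply, tsum_eq_sum (s := hP.toFinset), ENNReal.toReal_sum, Finset.sum_mul]
    · simp [ENNReal.toReal_mul, mul_assoc]
    · exact fun a _ => ENNReal.mul_ne_top (P.apply_ne_top a) ((f a).apply_ne_top b)
    · intro a ha
      have : P a = 0 := by simpa [PMF.mem_support_iff] using ha
      simp [this]
  have hs : ∀ a, Summable fun b => (f a b).toReal * F b := by
    intro a
    refine summable_of_hasFiniteSupport ((hf a).subset fun b hb => ?_)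
    rw [PMF.mem_support_iff]
    rintro h
    simp [h] at hb
  unfold mean
  simp_rw [key]
  rw [Summable.tsum_finsetSum fun a _ => (hs a).mul_left _]
  simp_rw [tsum_mul_left]

theorem mean_map {P : PMF α} (hP : P.support.Finite) (f : α → β) (F : β → ℝ) :
    mean (P.map f) F = mean P fun a => F (f a) := by
  have : P.map f = P.bind fun a => PMF.pure (f a) := rfl
  rw [this, mean_bind hP fun a => by simp]
  simp [mean_pure]

theorem mean_add {P : PMF α} (hP : P.support.Finite) (F G : α → ℝ) :
    mean P (fun a => F a + G a) = mean P F + mean P G := by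
  simp [mean_eq_sum hP, mul_add, Finset.sum_add_distrib]

theorem mean_const_mul (P : PMF α) (c : ℝ) (F : α → ℝ) :
    mean P (fun a => c * F a) = c * mean P F := by
  unfold mean
  rw [← tsum_mul_left]
  exact tsum_congr fun a => by ring

theorem mean_const (P : PMF α) (c : ℝ) : mean P (fun _ => c) = c := by
  unfold mean
  rw [tsum_mul_right, ← ENNReal.tsum_toReal_eq fun a => P.apply_ne_top a, P.tsum_coe]
  simp

theorem mean_mono {P : PMF α} (hP : P.support.Finite) {F G : α → ℝ} (h : ∀ a, F a ≤ G a) :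
    mean P F ≤ mean P G := by
  rw [mean_eq_sum hP, mean_eq_sum hP]
  exact Finset.sum_le_sum fun a _ => mul_le_mul_of_nonneg_left (h a) ENNReal.toReal_nonneg

end Mean

/-! ### One-step recursion for the controlled process -/

/-- The expectation of `φ` over the next state, given the next age `n`. -/
noncomputable def nextMean (p : unitInterval) (φ : State → ℝ) (n : ℕ) : ℝ :=
  (p : ℝ) * φ (n, true) + (1 - (p : ℝ)) * φ (n, false)

theorem mean_transition (p : unitInterval) (s : State) (a : Action) (φ : State → ℝ) :
    mean (transition p s a) φ = nextMean p φ (nextAge s a) := by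
  unfold transition
  rw [mean_map (Set.toFinite _)]
  unfold mean nextMean arrivalLaw
  simp [PMF.ofFintype_apply, ENNReal.toReal_ofReal p.2.1,
    ENNReal.toReal_ofReal (sub_nonneg.2 p.2.2)]

theorem support_transition_finite (p : unitInterval) (s : State) (a : Action) :
    (transition p s a).support.Finite := by
  unfold transition
  rw [PMF.support_map]
  exact (Set.toFinite _).image _

theorem support_historyLaw_finite (p : unitInterval) (μ : Policy) (s₀ : State) (t : ℕ) :
    (historyLaw p μ s₀ t).support.Finite := by
  induction t with
  | zero => simp [historyLaw]
  | succ t ih =>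
    rw [historyLaw, PMF.support_bind]
    refine ih.biUnion fun ω _ => ?_
    rw [PMF.support_bind]
    refine (Set.toFinite _).biUnion fun a _ => ?_
    rw [PMF.support_map]
    exact (support_transition_finite p _ _).image _

theorem mean_historyLaw_succ (p : unitInterval) (μ : Policy) (s₀ : State) (t : ℕ)
    (F : History × State → ℝ) :
    mean (historyLaw p μ s₀ (t + 1)) F =
      mean (historyLaw p μ s₀ t) fun ω => mean (μ ω.1 ω.2) fun a =>
        nextMean p (fun s' => F (ω.1 ++ [(ω.2, a)], s')) (nextAge ω.2 a) := by
  have hmap : ∀ (ω : History × State) (a : Action),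
      ((transition p ω.2 a).map fun s' => (ω.1 ++ [(ω.2, a)], s')).support.Finite := by
    intro ω a
    rw [PMF.support_map]
    exact (support_transition_finite p _ _).image _
  have hbind : ∀ ω : History × State, ((μ ω.1 ω.2).bind fun a =>
      (transition p ω.2 a).map fun s' => (ω.1 ++ [(ω.2, a)], s')).support.Finite := by
    intro ω
    rw [PMF.support_bind]
    exact (Set.toFinite _).biUnion fun a _ => hmap ω a
  rw [historyLaw, mean_bind (support_historyLaw_finite p μ s₀ t) hbind]
  congr 1
  funext ω
  rw [mean_bind (Set.toFinite _) (hmap ω)]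
  congr 1
  funext a
  rw [mean_map (support_transition_finite p _ _), mean_transition]

theorem totalCost_append (C : ℝ) (h : History) (s : State) (a : Action) :
    totalCost C (h ++ [(s, a)]) = totalCost C h + stageCost C s a := by
  simp [totalCost]

theorem stageCost_eq (C : ℝ) (s : State) (a : Action) :
    stageCost C s a = (nextAge s a : ℝ) + C * bit a := by
  obtain ⟨x, l⟩ := s
  cases a <;> cases l <;> simp [stageCost, nextAge, bit]

theorem nextMean_const_add (p : unitInterval) (c : ℝ) (φ : State → ℝ) (n : ℕ) :
    nextMean p (fun s => c + φ s) n = c + nextMean p φ n := by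
  unfold nextMean
  ring

/-- Expected cost so far plus a terminal cost `φ`, after `t` slots. -/
noncomputable def costToDate (p : unitInterval) (C : ℝ) (μ : Policy) (s₀ : State)
    (φ : State → ℝ) (t : ℕ) : ℝ :=
  mean (historyLaw p μ s₀ t) fun ω => totalCost C ω.1 + φ ω.2

theorem costToDate_zero (p : unitInterval) (C : ℝ) (μ : Policy) (s₀ : State) (φ : State → ℝ) :
    costToDate p C μ s₀ φ 0 = φ s₀ := by
  simp [costToDate, historyLaw, mean_pure, totalCost]

theorem costToDate_eq (p : unitInterval) (C : ℝ) (μ : Policy) (s₀ : State) (φ : State → ℝ)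
    (T : ℕ) : costToDate p C μ s₀ φ (T + 1) =
      expectedCost p C μ s₀ T + mean (historyLaw p μ s₀ (T + 1)) fun ω => φ ω.2 :=
  mean_add (support_historyLaw_finite p μ s₀ (T + 1)) _ _

theorem costToDate_succ (p : unitInterval) (C : ℝ) (μ : Policy) (s₀ : State) (φ : State → ℝ)
    (t : ℕ) : costToDate p C μ s₀ φ (t + 1) =
      mean (historyLaw p μ s₀ t) fun ω => totalCost C ω.1 + mean (μ ω.1 ω.2) fun a =>
        stageCost C ω.2 a + nextMean p φ (nextAge ω.2 a) := by
  unfold costToDate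
  rw [mean_historyLaw_succ]
  congr 1
  funext ω
  simp_rw [nextMean_const_add, totalCost_append, add_assoc]
  rw [mean_add (Set.toFinite _), mean_const]

/-- Telescoping of the Bellman inequality, for an arbitrary policy. -/
theorem mul_add_le_costToDate {p : unitInterval} {C g : ℝ} {φ : State → ℝ}
    (hφ : ∀ s a, g + φ s ≤ stageCost C s a + nextMean p φ (nextAge s a))
    (μ : Policy) (s₀ : State) (t : ℕ) :
    (t : ℝ) * g + φ s₀ ≤ costToDate p C μ s₀ φ t := by
  induction t with
  | zero => simp [costToDate_zero]
  | succ t ih =>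
    have hfin := support_historyLaw_finite p μ s₀ t
    have h1 : g + costToDate p C μ s₀ φ t ≤ costToDate p C μ s₀ φ (t + 1) := by
      rw [costToDate_succ, costToDate, ← mean_const (historyLaw p μ s₀ t) g, ← mean_add hfin]
      refine mean_mono hfin fun ω => ?_
      have h2 := mean_mono (P := μ ω.1 ω.2) (Set.toFinite _) (hφ ω.2)
      rw [mean_const] at h2
      linarith
    push_cast
    linarith

/-- Telescoping of the Poisson equation of a stationary policy. -/
theorem costToDate_stationary {p : unitInterval} {C g : ℝ} {φ : State → ℝ} {f : State → Action}
    (hφ : ∀ s, g + φ s = stageCost C s (f s) + nextMean p φ (nextAge s (f s)))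
    (s₀ : State) (t : ℕ) :
    costToDate p C (stationary f) s₀ φ t = (t : ℝ) * g + φ s₀ := by
  induction t with
  | zero => simp [costToDate_zero]
  | succ t ih =>
    have hfin := support_historyLaw_finite p (stationary f) s₀ t
    have h1 : costToDate p C (stationary f) s₀ φ (t + 1)
        = g + costToDate p C (stationary f) s₀ φ t := by
      rw [costToDate_succ, costToDate, ← mean_const (historyLaw p (stationary f) s₀ t) g,
        ← mean_add hfin]
      congr 1
      funext ω
      rw [stationary, mean_pure, ← hφ]
      ring
    rw [h1, ih]
    push_cast
    ring

/-- With a nonnegative update cost, the cost of a slot is at least the age it leads to. -/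
theorem expectedCost_add_mean_age_le {p : unitInterval} {C : ℝ} (hC : 0 ≤ C) (μ : Policy)
    (s₀ : State) (T : ℕ) :
    expectedCost p C μ s₀ T + mean (historyLaw p μ s₀ (T + 2)) (fun ω => (ω.2.1 : ℝ)) ≤
      expectedCost p C μ s₀ (T + 1) := by
  have hfin := support_historyLaw_finite p μ s₀ (T + 1)
  have h1 := costToDate_eq p C μ s₀ (fun _ => 0) (T + 1)
  rw [mean_const, add_zero, costToDate_succ] at h1
  rw [← h1, mean_historyLaw_succ]
  have h2 : expectedCost p C μ s₀ T = mean (historyLaw p μ s₀ (T + 1))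
    fun ω => totalCost C ω.1 := rfl
  rw [h2, ← mean_add hfin]
  refine mean_mono hfin fun ω => ?_
  gcongr
  refine mean_mono (Set.toFinite _) fun a => ?_
  have h3 : 0 ≤ C * bit a := mul_nonneg hC (by unfold bit; split_ifs <;> norm_num)
  rw [stageCost_eq]
  simp only [nextMean]
  linarith

/-! ### Verification lemmas for the average cost -/

/-- A sequence whose increments grow at least linearly is not bounded by a linear sequence. -/
theorem not_eventually_le_linear {d : ℕ → ℝ} {δ K c : ℝ} (hδ : 0 < δ)
    (hinc : ∀ᶠ t : ℕ in atTop, d t + (δ * t - K) ≤ d (t + 1)) :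
    ¬ ∀ᶠ t : ℕ in atTop, d t ≤ c * t := by
  intro hle
  have hbig : ∀ᶠ t : ℕ in atTop, c + 1 + K ≤ δ * t :=
    (tendsto_natCast_atTop_atTop.const_mul_atTop hδ).eventually_ge_atTop _
  obtain ⟨N, hN⟩ := eventually_atTop.1 ((hinc.and hle).and hbig)
  have hlin : ∀ k : ℕ, d N + (c + 1) * k ≤ d (N + k) := by
    intro k
    induction k with
    | zero => simp
    | succ k ih =>
      have h := hN (N + k) (Nat.le_add_right _ _)
      have h1 := h.1.1
      have h2 := h.2
      rw [← add_assoc]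
      push_cast at *
      linarith
  obtain ⟨k, hk⟩ := exists_nat_gt (c * N - d N)
  have h := (hN (N + k) (Nat.le_add_right _ _)).1.2
  have h' := hlin k
  push_cast at h
  linarith

/-- Verification: a solution of the Bellman inequality with at most linear growth bounds the
average cost of every policy from below. If the average cost of a policy were below `g`, the
terminal term would have to grow linearly in time; then so does the mean age, hence the total
cost grows quadratically. -/
theorem le_averageCost {p : unitInterval} {C g A B : ℝ} {φ : State → ℝ} (hC : 0 ≤ C)
    (hB : 0 < B) (hφ : ∀ s a, g + φ s ≤ stageCost C s a + nextMean p φ (nextAge s a))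
    (hgrowth : ∀ s, φ s ≤ A + B * s.1) (μ : Policy) (s₀ : State) :
    (g : EReal) ≤ averageCost p C μ s₀ := by
  by_contra hlt
  rw [not_le] at hlt
  obtain ⟨c, hc1, hc2⟩ := EReal.lt_iff_exists_real_btwn.1 hlt
  have hcg : c < g := EReal.coe_lt_coe_iff.1 hc2
  have hev : ∀ᶠ T : ℕ in atTop, expectedCost p C μ s₀ T ≤ c * ((T : ℝ) + 1) := by
    filter_upwards [eventually_lt_of_limsup_lt hc1] with T hT
    have h1 := EReal.coe_lt_coe_iff.1 hT
    have h2 : (0 : ℝ) < (T : ℝ) + 1 := by positivity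
    rw [one_div, inv_mul_lt_iff₀ h2] at h1
    linarith
  have hlow : ∀ᶠ T : ℕ in atTop, ((g - c) * (T : ℝ) - (A - φ s₀)) / B ≤
      mean (historyLaw p μ s₀ (T + 1)) fun ω => (ω.2.1 : ℝ) := by
    filter_upwards [hev] with T hT
    have hfin := support_historyLaw_finite p μ s₀ (T + 1)
    have h1 := mul_add_le_costToDate hφ μ s₀ (T + 1)
    rw [costToDate_eq] at h1
    have h2 := mean_mono hfin fun ω => hgrowth ω.2
    rw [mean_add hfin, mean_const, mean_const_mul] at h2
    rw [div_le_iff₀ hB]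
    push_cast at h1
    linarith
  refine not_eventually_le_linear (d := fun T => expectedCost p C μ s₀ T - c)
    (δ := (g - c) / B) (K := (A - φ s₀ - (g - c)) / B) (c := c)
    (div_pos (sub_pos.2 hcg) hB) ?_ ?_
  · filter_upwards [(tendsto_add_atTop_nat 1).eventually hlow] with T hT
    have h1 := expectedCost_add_mean_age_le (p := p) hC μ s₀ T
    have h2 : (g - c) / B * T - (A - φ s₀ - (g - c)) / B =
        ((g - c) * ((T + 1 : ℕ) : ℝ) - (A - φ s₀)) / B := by
      push_cast
      ring
    rw [h2]
    linarith
  · filter_upwards [hev] with T hT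
    linarith

/-- If a solution of the Poisson equation has bounded mean along the process, the average cost is
the constant of that equation. -/
theorem averageCost_stationary {p : unitInterval} {C g M : ℝ} {φ : State → ℝ}
    {f : State → Action} {s₀ : State}
    (hφ : ∀ s, g + φ s = stageCost C s (f s) + nextMean p φ (nextAge s (f s)))
    (hM : ∀ t, |mean (historyLaw p (stationary f) s₀ (t + 1)) fun ω => φ ω.2| ≤ M) :
    averageCost p C (stationary f) s₀ = (g : EReal) := by
  refine Tendsto.limsup_eq ?_
  rw [EReal.tendsto_coe, tendsto_iff_norm_sub_tendsto_zero]
  have hinv : Tendsto (fun T : ℕ => (|φ s₀| + M) * (1 / ((T : ℝ) + 1))) atTop (nhds 0) := by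
    simpa using tendsto_one_div_add_atTop_nhds_zero_nat.const_mul (|φ s₀| + M)
  refine squeeze_zero (fun _ => norm_nonneg _) (fun T => ?_) hinv
  have h1 := costToDate_stationary hφ s₀ (T + 1)
  rw [costToDate_eq] at h1
  have h2 : (0 : ℝ) < (T : ℝ) + 1 := by positivity
  push_cast at h1
  have h3 : 1 / ((T : ℝ) + 1) * expectedCost p C (stationary f) s₀ T - g = (φ s₀ -
      mean (historyLaw p (stationary f) s₀ (T + 1)) fun ω => φ ω.2) * (1 / ((T : ℝ) + 1)) := by
    rw [eq_sub_of_add_eq h1]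
    field_simp
    ring
  rw [h3, norm_mul, Real.norm_eq_abs, Real.norm_of_nonneg (by positivity)]
  gcongr
  exact (abs_sub _ _).trans (add_le_add le_rfl (hM T))

/-! ### Average cost of the threshold policies -/

/-- The average cost of the threshold policy with threshold `X ≥ 1`. -/
noncomputable def gain (p : unitInterval) (C : ℝ) (X : ℕ) : ℝ :=
  ((1 / (p : ℝ) - 1) * X + 1 + C + (1 / (p : ℝ) - 1) * (1 / (p : ℝ))
    + ((X : ℝ) - 1) * ((X : ℝ) + 2) / 2) / ((X : ℝ) - 1 + 1 / (p : ℝ))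

/-- The relative value of entering a slot with age `n`, before the arrival is revealed, under the
threshold policy with threshold `X`, normalized to vanish at age one. -/
noncomputable def relValue (p : unitInterval) (C : ℝ) (X n : ℕ) : ℝ :=
  if n ≤ X then ((n : ℝ) - 1) * (gain p C X - ((n : ℝ) + 2) / 2)
  else (1 / (p : ℝ) - 1) * n + 1 + C + (1 / (p : ℝ) - 1 - gain p C X) * (1 / (p : ℝ))

/-- The relative value of a state under the threshold policy with threshold `X`. -/
noncomputable def bias (p : unitInterval) (C : ℝ) (X : ℕ) (s : State) : ℝ :=
  stageCost C s (thresholdRule X s) - gain p C X + relValue p C X (nextAge s (thresholdRule X s))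

/-- The closed form of the Whittle index. -/
noncomputable def indexFormula (p : unitInterval) (x : ℕ) : ℝ :=
  (x : ℝ) ^ 2 / 2 - (x : ℝ) / 2 + (x : ℝ) / (p : ℝ)

variable {p : unitInterval} {C : ℝ} {X : ℕ}

theorem one_le_one_div (hp : 0 < (p : ℝ)) : 1 ≤ 1 / (p : ℝ) := by
  rw [le_div_iff₀ hp, one_mul]
  exact p.2.2

theorem cycle_pos (hp : 0 < (p : ℝ)) (hX : 1 ≤ X) : 0 < (X : ℝ) - 1 + 1 / (p : ℝ) := by
  have h1 := one_le_one_div hp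
  have h2 : (1 : ℝ) ≤ X := by exact_mod_cast hX
  linarith

theorem gain_mul (hp : 0 < (p : ℝ)) (hX : 1 ≤ X) :
    gain p C X * ((X : ℝ) - 1 + 1 / (p : ℝ)) = (1 / (p : ℝ) - 1) * X + 1 + C
      + (1 / (p : ℝ) - 1) * (1 / (p : ℝ)) + ((X : ℝ) - 1) * ((X : ℝ) + 2) / 2 :=
  div_mul_cancel₀ _ (cycle_pos hp hX).ne'

/-- The defining equation of the gain is that the two branches of `relValue` agree at `X`. -/
theorem relValue_of_ge (hp : 0 < (p : ℝ)) (hX : 1 ≤ X) {n : ℕ} (hn : X ≤ n) :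
    relValue p C X n =
      (1 / (p : ℝ) - 1) * n + 1 + C + (1 / (p : ℝ) - 1 - gain p C X) * (1 / (p : ℝ)) := by
  unfold relValue
  split_ifs with h
  · obtain rfl : n = X := le_antisymm h hn
    have := gain_mul (C := C) hp hX
    linear_combination this
  · rfl

theorem relValue_of_le {n : ℕ} (hn : n ≤ X) :
    relValue p C X n = ((n : ℝ) - 1) * (gain p C X - ((n : ℝ) + 2) / 2) := if_pos hn

theorem relValue_one (hX : 1 ≤ X) : relValue p C X 1 = 0 := by
  simp [relValue_of_le hX]

theorem bias_false (x : ℕ) :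
    bias p C X (x, false) = (x : ℝ) + 1 - gain p C X + relValue p C X (x + 1) := by
  simp [bias, thresholdRule, nextAge, stageCost, bit]

theorem bias_true_of_lt {x : ℕ} (hx : x < X) :
    bias p C X (x, true) = (x : ℝ) + 1 - gain p C X + relValue p C X (x + 1) := by
  simp [bias, thresholdRule, nextAge, stageCost, bit, hx.not_ge]

theorem bias_true_of_ge (hX : 1 ≤ X) {x : ℕ} (hx : X ≤ x) :
    bias p C X (x, true) = 1 + C - gain p C X := by
  simp [bias, thresholdRule, nextAge, stageCost, bit, hx, relValue_one hX]

theorem nextMean_bias (hp : 0 < (p : ℝ)) (hX : 1 ≤ X) (n : ℕ) :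
    nextMean p (bias p C X) n = relValue p C X n := by
  unfold nextMean
  rw [bias_false]
  rcases lt_or_ge n X with hn | hn
  · rw [bias_true_of_lt hn, relValue_of_le hn, relValue_of_le hn.le]
    push_cast
    ring
  · rw [bias_true_of_ge hX hn, relValue_of_ge hp hX hn,
      relValue_of_ge hp hX (hn.trans n.le_succ)]
    push_cast
    field_simp
    ring

/-- The Poisson equation of the threshold policy. -/
theorem gain_add_bias (hp : 0 < (p : ℝ)) (hX : 1 ≤ X) (s : State) :
    gain p C X + bias p C X s = stageCost C s (thresholdRule X s)
      + nextMean p (bias p C X) (nextAge s (thresholdRule X s)) := by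
  rw [nextMean_bias hp hX, bias]
  ring

theorem nextAge_le (s : State) (a : Action) : nextAge s a ≤ s.1 + 1 := by
  unfold nextAge
  split_ifs <;> omega

theorem abs_bias_le (hp : 0 < (p : ℝ)) (X : ℕ) (C : ℝ) :
    ∃ A : ℝ, ∀ s, |bias p C X s| ≤ A + 1 / (p : ℝ) * s.1 := by
  have hq := one_le_one_div hp
  set q := 1 / (p : ℝ)
  have hR : ∀ n : ℕ, |relValue p C X n| ≤ ((X : ℝ) + 1) * (|gain p C X| + ((X : ℝ) + 2) / 2)
      + |1 + C + (q - 1 - gain p C X) * q| + (q - 1) * n := by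
    intro n
    have hn0 : 0 ≤ (q - 1) * n := mul_nonneg (by linarith) n.cast_nonneg
    have hb := abs_nonneg (1 + C + (q - 1 - gain p C X) * q)
    unfold relValue
    split_ifs with h
    · have hn : (n : ℝ) ≤ X := by exact_mod_cast h
      have hn' : (0 : ℝ) ≤ n := n.cast_nonneg
      have h1 : |(n : ℝ) - 1| ≤ (X : ℝ) + 1 := abs_le.2 ⟨by linarith, by linarith⟩
      have h2 : |gain p C X - ((n : ℝ) + 2) / 2| ≤ |gain p C X| + ((X : ℝ) + 2) / 2 := by
        refine (abs_sub _ _).trans ?_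
        rw [abs_of_nonneg (by linarith : 0 ≤ ((n : ℝ) + 2) / 2)]
        linarith
      rw [abs_mul]
      have := mul_le_mul h1 h2 (abs_nonneg _) (by linarith)
      linarith
    · have h0 : 0 ≤ ((X : ℝ) + 1) * (|gain p C X| + ((X : ℝ) + 2) / 2) := by positivity
      have : (1 / (p : ℝ) - 1) * (n : ℝ) + 1 + C + (1 / (p : ℝ) - 1 - gain p C X) * (1 / (p : ℝ))
          = (q - 1) * n + (1 + C + (q - 1 - gain p C X) * q) := by ring
      rw [this]
      refine (abs_add_le _ _).trans ?_
      rw [abs_of_nonneg hn0]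
      linarith
  refine ⟨((X : ℝ) + 1) * (|gain p C X| + ((X : ℝ) + 2) / 2)
      + |1 + C + (q - 1 - gain p C X) * q| + (q - 1) + 1 + |C| + |gain p C X|, fun s => ?_⟩
  have hR' := hR (nextAge s (thresholdRule X s))
  have hn : (nextAge s (thresholdRule X s) : ℝ) ≤ s.1 + 1 := by
    exact_mod_cast nextAge_le s (thresholdRule X s)
  have hn0 : (0 : ℝ) ≤ nextAge s (thresholdRule X s) := Nat.cast_nonneg _
  have hCb : |C * bit (thresholdRule X s)| ≤ |C| := by
    unfold bit
    split_ifs <;> simp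
  have h1 := mul_le_mul_of_nonneg_left hn (by linarith : 0 ≤ q - 1)
  rw [bias, stageCost_eq]
  rw [abs_le] at *
  have hg := neg_abs_le (gain p C X)
  have hg' := le_abs_self (gain p C X)
  constructor <;> linarith [hR'.1, hR'.2, hCb.1, hCb.2]

/-- The mean age stays bounded under a threshold policy, as the age `n` before an arrival is
revealed is followed by a mean age of at most `(1 - p) n + 1 + X`. -/
theorem mean_age_le (hp : 0 < (p : ℝ)) (X : ℕ) (s₀ : State) :
    ∃ M : ℝ, ∀ t, mean (historyLaw p (stationary (thresholdRule X)) s₀ (t + 1))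
      (fun ω => (ω.2.1 : ℝ)) ≤ M := by
  have hstep : ∀ t : ℕ,
      mean (historyLaw p (stationary (thresholdRule X)) s₀ (t + 1)) (fun ω => (ω.2.1 : ℝ)) =
        mean (historyLaw p (stationary (thresholdRule X)) s₀ t)
          fun ω => (nextAge ω.2 (thresholdRule X ω.2) : ℝ) := by
    intro t
    rw [mean_historyLaw_succ]
    congr 1
    funext ω
    rw [stationary, mean_pure, nextMean]
    ring
  have hdrift : ∀ n : ℕ, nextMean p (fun s => (nextAge s (thresholdRule X s) : ℝ)) n ≤
      (1 + X) + (1 - (p : ℝ)) * n := by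
    intro n
    have hp1 : (p : ℝ) ≤ 1 := p.2.2
    have hX : (0 : ℝ) ≤ X := X.cast_nonneg
    rcases lt_or_ge n X with h | h
    · have hn : (n : ℝ) ≤ X := by exact_mod_cast h.le
      simp only [nextMean, thresholdRule, nextAge]
      simp [h.not_ge]
      nlinarith
    · simp [nextMean, thresholdRule, nextAge, h]
      linarith
  set m : ℕ → ℝ := fun t => mean (historyLaw p (stationary (thresholdRule X)) s₀ (t + 1))
    fun ω => (ω.2.1 : ℝ) with hm
  have hrec : ∀ t, m (t + 1) ≤ (1 + X) + (1 - (p : ℝ)) * m t := by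
    intro t
    have h1 : m (t + 1) = mean (historyLaw p (stationary (thresholdRule X)) s₀ (t + 1))
        fun ω => (nextAge ω.2 (thresholdRule X ω.2) : ℝ) := hstep (t + 1)
    have hfin := support_historyLaw_finite p (stationary (thresholdRule X)) s₀ t
    simp only [hm] at h1 ⊢
    rw [h1, mean_historyLaw_succ, hstep t, ← mean_const_mul,
      ← mean_const (historyLaw p (stationary (thresholdRule X)) s₀ t) (1 + (X : ℝ)),
      ← mean_add hfin]
    refine mean_mono hfin fun ω => ?_
    rw [stationary, mean_pure]
    exact hdrift _
  refine ⟨max (m 0) ((1 + X) / (p : ℝ)), fun t => ?_⟩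
  change m t ≤ _
  set M := max (m 0) ((1 + X) / (p : ℝ))
  have hM : 1 + (X : ℝ) ≤ p * M := by
    have : (1 + X) / (p : ℝ) ≤ M := le_max_right _ _
    rwa [div_le_iff₀' hp] at this
  induction t with
  | zero => exact le_max_left _ _
  | succ t ih =>
    have h1 := mul_le_mul_of_nonneg_left ih (sub_nonneg.2 p.2.2)
    linarith [hrec t]

theorem averageCost_threshold (hp : 0 < (p : ℝ)) (hX : 1 ≤ X) (C : ℝ) (s₀ : State) :
    averageCost p C (stationary (thresholdRule X)) s₀ = (gain p C X : EReal) := by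
  obtain ⟨A, hA⟩ := abs_bias_le hp X C
  obtain ⟨M, hM⟩ := mean_age_le hp X s₀
  refine averageCost_stationary (M := A + 1 / (p : ℝ) * M) (gain_add_bias hp hX) fun t => ?_
  have hfin := support_historyLaw_finite p (stationary (thresholdRule X)) s₀ (t + 1)
  have h1 := mul_le_mul_of_nonneg_left (hM t) (one_div_pos.2 hp).le
  have h2 := mean_mono hfin fun ω => (abs_le.1 (hA ω.2)).2
  have h3 := mean_mono hfin fun ω => (abs_le.1 (hA ω.2)).1
  simp_rw [neg_eq_neg_one_mul (A + _)] at h3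
  rw [mean_const_mul] at h3
  rw [mean_add hfin, mean_const, mean_const_mul] at h2 h3
  rw [abs_le]
  constructor <;> linarith

/-! ### The index and the optimality of thresholds -/

theorem indexFormula_zero : indexFormula p 0 = 0 := by
  simp [indexFormula]

theorem indexFormula_strictMono (hp : 0 < (p : ℝ)) : StrictMono (indexFormula p) := by
  refine strictMono_nat_of_lt_succ fun n => ?_
  have h1 := one_le_one_div hp
  have h2 : (0 : ℝ) ≤ n := n.cast_nonneg
  have h3 : indexFormula p (n + 1) - indexFormula p n = n + 1 / (p : ℝ) := by
    unfold indexFormula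
    push_cast
    ring
  linarith

theorem gain_le_iff (hp : 0 < (p : ℝ)) (hX : 1 ≤ X) :
    gain p C X ≤ (X : ℝ) + 1 / (p : ℝ) ↔ C ≤ indexFormula p X := by
  rw [gain, div_le_iff₀ (cycle_pos hp hX), indexFormula, ← sub_nonneg,
    ← sub_nonneg (b := C)]
  exact iff_of_eq (congrArg _ (by ring))

theorem le_gain_iff (hp : 0 < (p : ℝ)) (hX : 1 ≤ X) :
    (X : ℝ) - 1 + 1 / (p : ℝ) ≤ gain p C X ↔ indexFormula p (X - 1) ≤ C := by
  rw [gain, le_div_iff₀ (cycle_pos hp hX), indexFormula, Nat.cast_sub hX, ← sub_nonneg,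
    ← sub_nonneg (a := C)]
  push_cast
  exact iff_of_eq (congrArg _ (by ring))

/-- The gain at `X + 1` is a weighted mean of the gain at `X` and of `X + 1 / p`. -/
theorem gain_succ_mul (hp : 0 < (p : ℝ)) (hX : 1 ≤ X) :
    (gain p C (X + 1) - gain p C X) * ((X : ℝ) + 1 / (p : ℝ)) =
      (X : ℝ) + 1 / (p : ℝ) - gain p C X := by
  have h1 := gain_mul (C := C) hp hX
  have h2 := gain_mul (C := C) hp (Nat.le_add_left 1 X)
  push_cast at h2
  linear_combination h2 - h1

theorem gain_le_gain_succ_iff (hp : 0 < (p : ℝ)) (hX : 1 ≤ X) :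
    gain p C X ≤ gain p C (X + 1) ↔ C ≤ indexFormula p X := by
  have h0 : 0 < (X : ℝ) + 1 / (p : ℝ) := by linarith [cycle_pos hp hX]
  rw [← gain_le_iff hp hX, ← sub_nonneg, ← sub_nonneg (b := gain p C X), ← gain_succ_mul hp hX,
    mul_nonneg_iff_of_pos_right h0]

theorem gain_succ_le_gain_iff (hp : 0 < (p : ℝ)) (hX : 1 ≤ X) :
    gain p C (X + 1) ≤ gain p C X ↔ indexFormula p X ≤ C := by
  have h0 : 0 < (X : ℝ) + 1 / (p : ℝ) := by linarith [cycle_pos hp hX]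
  have h1 := le_gain_iff (C := C) hp (Nat.le_add_left 1 X)
  rw [Nat.add_sub_cancel] at h1
  rw [← h1]
  have h2 := gain_succ_mul (C := C) hp hX
  have hc := cycle_pos hp hX
  have h5 : (gain p C (X + 1) - gain p C X) * ((X : ℝ) - 1 + 1 / (p : ℝ)) =
      ((X + 1 : ℕ) : ℝ) - 1 + 1 / (p : ℝ) - gain p C (X + 1) := by
    push_cast
    linear_combination h2
  constructor
  · intro h
    have := mul_nonpos_of_nonpos_of_nonneg (sub_nonpos.2 h) hc.le
    linarith
  · intro h
    by_contra! hlt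
    have := mul_pos (sub_pos.2 hlt) hc
    linarith

/-- The Bellman inequality: when `C` lies between the indices at `X - 1` and `X`, no action
improves on the threshold policy with threshold `X`. -/
theorem bellman (hp : 0 < (p : ℝ)) (hX : 1 ≤ X) (hC : 0 ≤ C)
    (hlo : indexFormula p (X - 1) ≤ C) (hhi : C ≤ indexFormula p X) (s : State) (a : Action) :
    gain p C X + bias p C X s ≤ stageCost C s a + nextMean p (bias p C X) (nextAge s a) := by
  have hq := one_le_one_div hp
  have hg1 := (le_gain_iff hp hX).2 hlo
  have hg2 := (gain_le_iff hp hX).2 hhi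
  have hgm := gain_mul (C := C) hp hX
  rw [nextMean_bias hp hX]
  obtain ⟨x, l⟩ := s
  cases l
  · rw [bias_false]
    cases a <;> simp [stageCost, nextAge, bit]
    · linarith
    · linarith
  · rcases lt_or_ge x X with hx | hx
    · rw [bias_true_of_lt hx]
      cases a
      · simp [stageCost, nextAge, bit]
        linarith
      · simp only [stageCost, nextAge, bit]
        simp only [and_self, if_true, relValue_one hX]
        rw [relValue_of_le (n := x + 1) hx]
        have hx' : (x : ℝ) + 1 ≤ X := by exact_mod_cast hx
        -- Idling is most expensive, among the ages below `X`, at age `X - 1`.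
        have h1 : (x : ℝ) * (gain p C X - ((x : ℝ) + 1) / 2)
            ≤ ((X : ℝ) - 1) * (gain p C X - (X : ℝ) / 2) := by
          have := mul_nonneg (by linarith : 0 ≤ (X : ℝ) - 1 - x)
            (by linarith : 0 ≤ gain p C X - ((X : ℝ) + x) / 2)
          nlinarith
        have h2 : ((X : ℝ) - 1) * (gain p C X - (X : ℝ) / 2) ≤ C := by
          have := mul_nonneg (by linarith : 0 ≤ 1 / (p : ℝ)) (sub_nonneg.2 hg1)
          nlinarith
        push_cast
        linarith
    · rw [bias_true_of_ge hX hx]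
      cases a
      · -- Idling is cheapest, among the ages from `X` on, at age `X`.
        simp only [stageCost, nextAge, bit]
        simp only [Bool.false_eq_true, false_and, if_false]
        rw [relValue_of_ge hp hX (hx.trans x.le_succ)]
        have hx' : (X : ℝ) ≤ x := by exact_mod_cast hx
        have h1 := mul_nonneg (by linarith : 0 ≤ 1 / (p : ℝ)) (sub_nonneg.2 hg2)
        have h2 := mul_nonneg (by linarith : 0 ≤ 1 / (p : ℝ)) (sub_nonneg.2 hx')
        push_cast
        nlinarith
      · simp [stageCost, nextAge, bit, relValue_one hX]

/-- A threshold whose index interval contains `C` is optimal among all policies. The hypothesis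
`0 ≤ C` rules out that updating without an arrival pays. -/
theorem optimalThreshold_of_mem (hp : 0 < (p : ℝ)) (hX : 1 ≤ X) (hC : 0 ≤ C)
    (hlo : indexFormula p (X - 1) ≤ C) (hhi : C ≤ indexFormula p X) :
    OptimalThreshold p C X := by
  refine ⟨hX, fun s₀ _ ν => ?_⟩
  rw [averageCost_threshold hp hX]
  obtain ⟨A, hA⟩ := abs_bias_le hp X C
  exact le_averageCost hC (one_div_pos.2 hp) (bellman hp hX hC hlo hhi)
    (fun s => (abs_le.1 (hA s)).2) ν s₀

theorem OptimalThreshold.gain_le (hp : 0 < (p : ℝ)) (h : OptimalThreshold p C X) {Y : ℕ}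
    (hY : 1 ≤ Y) : gain p C X ≤ gain p C Y := by
  have h1 := h.2 (1, true) le_rfl (stationary (thresholdRule Y))
  rwa [averageCost_threshold hp h.1, averageCost_threshold hp hY, EReal.coe_le_coe_iff] at h1

/-- Comparison with the threshold `X + 1` alone bounds `C` from above; no sign of `C` is needed. -/
theorem OptimalThreshold.le_indexFormula (hp : 0 < (p : ℝ)) (h : OptimalThreshold p C X) :
    C ≤ indexFormula p X :=
  (gain_le_gain_succ_iff hp h.1).1 (h.gain_le hp (Nat.le_add_left 1 X))

/-- Comparison with the threshold `X - 1` alone bounds `C` from below. -/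
theorem OptimalThreshold.indexFormula_le (hp : 0 < (p : ℝ)) {x : ℕ} (hx : 1 ≤ x)
    (h : OptimalThreshold p C X) (hxX : x < X) : indexFormula p x ≤ C := by
  obtain ⟨Y, rfl⟩ := Nat.exists_eq_add_one_of_ne_zero (Nat.ne_zero_of_lt hxX)
  have hY : x ≤ Y := Nat.lt_succ_iff.1 hxX
  exact ((indexFormula_strictMono hp).monotone hY).trans
    ((gain_succ_le_gain_iff hp (hx.trans hY)).1 (h.gain_le hp (hx.trans hY)))

theorem indexFormula_nonneg (hp : 0 < (p : ℝ)) (x : ℕ) : 0 ≤ indexFormula p x := by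
  rw [← indexFormula_zero (p := p)]
  exact (indexFormula_strictMono hp).monotone x.zero_le

theorem equallyDesirable_iff (hp : 0 < (p : ℝ)) {x : ℕ} (hx : 1 ≤ x) :
    EquallyDesirable p C x ↔ C = indexFormula p x := by
  constructor
  · rintro ⟨⟨X, hX, hXx⟩, ⟨Y, hY, hYx⟩⟩
    have hXx' : X ≤ x := by simpa [thresholdRule] using hXx
    have hYx' : x < Y := by simpa [thresholdRule] using hYx
    exact le_antisymm
      ((hX.le_indexFormula hp).trans ((indexFormula_strictMono hp).monotone hXx'))
      (hY.indexFormula_le hp hx hYx')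
  · rintro rfl
    -- At `C = I(x, 1)` both thresholds `x` and `x + 1` are optimal.
    have hmono := (indexFormula_strictMono hp).monotone
    have h0 := indexFormula_nonneg hp x
    exact ⟨⟨x, optimalThreshold_of_mem hp hx h0 (hmono (Nat.sub_le _ _)) le_rfl,
        by simp [thresholdRule]⟩,
      ⟨x + 1, optimalThreshold_of_mem hp (Nat.le_add_left 1 x) h0 le_rfl (hmono x.le_succ),
        by simp [thresholdRule]⟩⟩

theorem whittleIndex_eq (hp : 0 < (p : ℝ)) (x : ℕ) : whittleIndex p x = indexFormula p x := by
  rcases Nat.eq_zero_or_pos x with rfl | hx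
  · simp [whittleIndex, indexFormula_zero]
  · rw [whittleIndex, if_neg hx.ne']
    exact (equallyDesirable_iff hp hx).1
      (Classical.epsilon_spec (p := fun C => EquallyDesirable p C x)
        ⟨_, (equallyDesirable_iff hp hx).2 rfl⟩)

theorem idlingOptimalThreshold_iff (hp : 0 < (p : ℝ)) (hC : 0 ≤ C) (hX : 1 ≤ X) :
    IdlingOptimalThreshold p C X ↔ indexFormula p (X - 1) ≤ C ∧ C < indexFormula p X := by
  have hstrict := indexFormula_strictMono hp
  constructor
  · rintro ⟨hopt, hidle⟩
    refine ⟨?_, (hopt.le_indexFormula hp).lt_of_ne fun hCX => ?_⟩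
    · rcases Nat.eq_zero_or_pos (X - 1) with h | h
      · rwa [h, indexFormula_zero]
      · exact hopt.indexFormula_le hp h (by omega)
    · have := hidle X hX ((equallyDesirable_iff hp hX).2 hCX).2
      simp [thresholdRule] at this
  · rintro ⟨hlo, hhi⟩
    refine ⟨optimalThreshold_of_mem hp hX hC hlo hhi.le, fun x hx => ?_⟩
    rintro ⟨Y, hY, hYx⟩
    have hYx' : x < Y := by simpa [thresholdRule] using hYx
    have := hstrict.lt_iff_lt.1 ((hY.indexFormula_le hp hx hYx').trans_lt hhi)
    simpa [thresholdRule] using this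

theorem exists_lt_indexFormula (hp : 0 < (p : ℝ)) (C : ℝ) : ∃ x, C < indexFormula p x := by
  obtain ⟨x, hx⟩ := exists_nat_gt C
  refine ⟨x, hx.trans_le ?_⟩
  have h1 := mul_le_mul_of_nonneg_left (one_le_one_div hp) x.cast_nonneg
  have h2 : (0 : ℝ) ≤ (x : ℝ) * ((x : ℝ) - 1) := by
    rcases Nat.eq_zero_or_pos x with rfl | h
    · simp
    · exact mul_nonneg x.cast_nonneg (sub_nonneg.2 (by exact_mod_cast h))
  have h3 : indexFormula p x = (x : ℝ) * ((x : ℝ) - 1) / 2 + x * (1 / (p : ℝ)) := by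
    unfold indexFormula
    ring
  linarith

theorem IdlingOptimalThreshold.mono (hp : 0 < (p : ℝ)) {C₁ C₂ : ℝ} (hC₁ : 0 ≤ C₁)
    (hC : C₁ ≤ C₂) {X₁ X₂ : ℕ} (h₁ : IdlingOptimalThreshold p C₁ X₁)
    (h₂ : IdlingOptimalThreshold p C₂ X₂) : X₁ ≤ X₂ := by
  have k₁ := (idlingOptimalThreshold_iff hp hC₁ h₁.1.1).1 h₁
  have k₂ := (idlingOptimalThreshold_iff hp (hC₁.trans hC) h₂.1.1).1 h₂
  have := (indexFormula_strictMono hp).lt_iff_lt.1 ((k₁.1.trans hC).trans_lt k₂.2)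
  omega

theorem exists_idlingOptimalThreshold (hp : 0 < (p : ℝ)) (hC : 0 ≤ C) :
    ∃ X, IdlingOptimalThreshold p C X := by
  classical
  have hex := exists_lt_indexFormula hp C
  have hpos : 1 ≤ Nat.find hex := by
    rw [Nat.one_le_iff_ne_zero]
    intro h
    have := Nat.find_spec hex
    rw [h, indexFormula_zero] at this
    linarith
  exact ⟨Nat.find hex, (idlingOptimalThreshold_iff hp hC hpos).2
    ⟨not_lt.1 (Nat.find_min hex (by omega)), Nat.find_spec hex⟩⟩

end AgeMDP

theorem theorem5 (p : unitInterval) (hp : 0 < (p : ℝ)) :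
    -- the Whittle index is well defined and has the stated closed form
    (∀ x : ℕ, 1 ≤ x →
      (∀ C : ℝ, AgeMDP.EquallyDesirable p C x ↔ C = AgeMDP.whittleIndex p x) ∧
      AgeMDP.whittleIndex p x = (x : ℝ) ^ 2 / 2 - (x : ℝ) / 2 + (x : ℝ) / (p : ℝ)) ∧
    -- for every nonnegative update cost there is exactly one optimal threshold
    (∀ C : ℝ, 0 ≤ C → ∃! X : ℕ, AgeMDP.IdlingOptimalThreshold p C X) ∧
    -- the optimal threshold is `x` exactly when `I(x - 1, 1) ≤ C < I(x, 1)`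
    (∀ C : ℝ, 0 ≤ C → ∀ x : ℕ, 1 ≤ x →
      (AgeMDP.IdlingOptimalThreshold p C x ↔
        AgeMDP.whittleIndex p (x - 1) ≤ C ∧ C < AgeMDP.whittleIndex p x)) ∧
    -- the optimal threshold is nondecreasing in the update cost
    (∀ C₁ C₂ : ℝ, 0 ≤ C₁ → C₁ ≤ C₂ → ∀ X₁ X₂ : ℕ,
      AgeMDP.IdlingOptimalThreshold p C₁ X₁ → AgeMDP.IdlingOptimalThreshold p C₂ X₂ →
        X₁ ≤ X₂) := by
  simp only [AgeMDP.whittleIndex_eq hp]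
  refine ⟨fun x hx => ⟨fun C => AgeMDP.equallyDesirable_iff hp hx, rfl⟩, fun C hC => ?_,
    fun C hC x hx => AgeMDP.idlingOptimalThreshold_iff hp hC hx,
    fun C₁ C₂ hC₁ hC X₁ X₂ h₁ h₂ => h₁.mono hp hC₁ hC h₂⟩
  obtain ⟨X, hX⟩ := AgeMDP.exists_idlingOptimalThreshold hp hC
  exact ⟨X, hX, fun Y hY => le_antisymm (hY.mono hp hC le_rfl hX) (hX.mono hp hC le_rfl hY)⟩
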